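/- Let $\mathbb{D}$ be the open unit disc and $\mathbb{T}$ the unit circle in $\mathbb{C}$, and let $r(A)$ denote the spectral radius of a square matrix $A$. Let $\lambda_1,\lambda_2\in\mathbb{D}$ be distinct points, let $W_1,W_2$ be $2\times 2$ complex matrices with $r(W_1)<1$ and $r(W_2)<1$, neither of which is a scalar multiple of the identity, and let $s_j=\operatorname{tr}W_j$, $p_j=\det W_j$ for $j=1,2$. Then the denominator in (2) below does not vanish for any $\omega\in\mathbb{T}$, and the following three statements are equivalent: (1) there exists an analytic function $F:\mathbb{D}\to\mathbb{C}^{2\times 2}$ such that $F(\lambda_1)=W_1$, $F(\lambda_2)=W_2$ and $r(F(\lambda))\le 1$ for all $\lambda\in\mathbb{D}$; (2) the following maximum is attained and satisfies $$\max_{\omega\in\mathbb{T}}\left|\frac{(s_2p_1-s_1p_2)\omega^2+2(p_2-p_1)\omega+s_1-s_2}{(s_1-\bar s_2p_1)\omega^2-2(1-p_1\bar p_2)\omega+\bar s_2-s_1\bar p_2}\right|\le\left|\frac{\lambda_1-\lambda_2}{1-\bar\lambda_2\lambda_1}\right|;$$ (3) for all $\omega\in\mathbb{T}$, the $2\times 2$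 matrix $$\left[\frac{\overline{(2-\omega s_i)}\,(2-\omega s_j)-\overline{(2\omega p_i-s_i)}\,(2\omega p_j-s_j)}{1-\bar\lambda_i\lambda_j}\right]_{i,j=1}^2$$ is positive semidefinite. -/

import Mathlib

open Complex ComplexConjugate
open scoped ComplexOrder

noncomputable section

/-- The open unit disc in the complex plane. -/
def openDisc : Set ℂ := Metric.ball 0 1

/-- The unit circle in the complex plane. -/
def unitCircle : Set ℂ := Metric.sphere 0 1

/-- A square matrix is nonscalar if it is not a scalar multiple of the identity. -/
def IsNonscalar (A : Matrix (Fin 2) (Fin 2) ℂ) : Prop :=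
  ∀ c : ℂ, A ≠ c • (1 : Matrix (Fin 2) (Fin 2) ℂ)

/-- Analyticity of a matrix-valued function on a set, that is, of each of its entries.
Only the values of the function near the set matter. -/
def IsAnalyticMatrixOn (F : ℂ → Matrix (Fin 2) (Fin 2) ℂ) (U : Set ℂ) : Prop :=
  ∀ i j, AnalyticOnNhd ℂ (fun z => F z i j) U

/-- The pseudohyperbolic distance on the unit disc. -/
def pseudohyperbolicDist (z w : ℂ) : ℝ := ‖(z - w) / (1 - conj w * z)‖

/-- The numerator of the rational function of `ω` attached to `(s₁, p₁)` and `(s₂, p₂)`. -/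
def ratioNum (s₁ p₁ s₂ p₂ ω : ℂ) : ℂ :=
  (s₂ * p₁ - s₁ * p₂) * ω ^ 2 + 2 * (p₂ - p₁) * ω + s₁ - s₂

/-- The denominator of the rational function of `ω` attached to `(s₁, p₁)` and `(s₂, p₂)`. -/
def ratioDen (s₁ p₁ s₂ p₂ ω : ℂ) : ℂ :=
  (s₁ - conj s₂ * p₁) * ω ^ 2 - 2 * (1 - p₁ * conj p₂) * ω + conj s₂ - s₁ * conj p₂

/-- The Pick-type matrix attached to nodes `lam`, to pairs `(s j, p j)` and to `ω`. -/
def pickMatrix (lam s p : Fin 2 → ℂ) (ω : ℂ) : Matrix (Fin 2) (Fin 2) ℂ :=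
  Matrix.of fun i j =>
    (conj (2 - ω * s i) * (2 - ω * s j) - conj (2 * ω * p i - s i) * (2 * ω * p j - s j)) /
      (1 - conj (lam i) * lam j)

end

/-! For a matrix with spectral radius less than 1 (at most 1), the pair (s, p) = (trace,
determinant) lies in the open (closed) symmetrized bidisc. For |ω| = 1 the function Φ_ω(s, p) = (2ωp
- s)/(2 - ωs) maps the open one into the disc, and the ratio in (2) is the pseudohyperbolic distance
of Φ_ω(s₁, p₁) and Φ_ω(s₂, p₂) (`norm_ratio`). So (2) and (3) agree for each ω by the two-point Pick
criterion (`pick_two_posSemidef_iff`), and (1) implies (2) by Schwarz–Pick applied to Φ_ω ∘ (tr F,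
det F) (`ratio_le_of_analytic`).

For (2) implies (1), a rotation moves a maximizing ω to 1. After a Cayley transform of the two
roots, let σ be their mean and w the square of half their difference. The ratio at 1 depends only on
σ₁, σ₂, and the other ω become imaginary translations σ - iτ, with τ → ±∞ at ω = 1. Maximality there
is a first-order condition at τ = ∞. It says exactly that w_j = ασ_j² + iβσ_j + γ with real α, β, γ
(`exists_quadratic_of_halfPlaneForm`), and the inequalities for finite τ give α ≤ 1 and ατ² + βτ - γ
≥ 0 (`quadratic_bounds_of_halfPlaneForm`). Under these bounds σ ↦ (σ, ασ² + iβσ + γ) keeps both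
roots σ ± √w in the closed right half-plane (`re_nonneg_of_sq_eq_quadratic`). Composing with a Pick
interpolant from the disc to the half-plane (`exists_halfPlane_map`) gives an analytic disc of
pairs, which lifts to matrices because two nonscalar matrices share a cyclic vector
(`exists_matrix_lift`). -/

/-! ### Two-point Pick matrices and Schwarz–Pick. -/

/-- A Hermitian `2 × 2` matrix with positive diagonal is positive semidefinite iff its determinant
is nonnegative. -/
theorem posSemidef_two_iff {x y : ℝ} (hx : 0 < x) (z : ℂ) :
    (!![(x : ℂ), z; conj z, (y : ℂ)]).PosSemidef ↔ ‖z‖ ^ 2 ≤ x * y := by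
  constructor
  · intro h
    have h1 := h.det_nonneg
    rw [Matrix.det_fin_two_of, Complex.mul_conj, Complex.normSq_eq_norm_sq] at h1
    have h2 : (0 : ℂ) ≤ ((x * y - ‖z‖ ^ 2 : ℝ) : ℂ) := by push_cast at h1 ⊢; exact h1
    rw [Complex.zero_le_real] at h2
    linarith
  · intro h
    rw [Matrix.posSemidef_iff_dotProduct_mulVec]
    refine ⟨?_, fun u => ?_⟩
    · ext i j
      fin_cases i <;> fin_cases j <;> simp [Matrix.conjTranspose]
    -- Completing the square in `u 0`, which needs only `x` to be positive.
    · have key : star u ⬝ᵥ (!![(x : ℂ), z; conj z, (y : ℂ)].mulVec u) =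
          (((‖x * u 0 + z * u 1‖ ^ 2 + (x * y - ‖z‖ ^ 2) * ‖u 1‖ ^ 2) / x : ℝ) : ℂ) := by
        have hx' : (x : ℂ) ≠ 0 := by exact_mod_cast hx.ne'
        simp only [dotProduct, Matrix.mulVec, Fin.sum_univ_two]
        push_cast
        simp only [← Complex.mul_conj']
        simp
        field_simp
        ring
      rw [key, Complex.zero_le_real]
      have : 0 ≤ x * y - ‖z‖ ^ 2 := by linarith
      positivity

/-- The Gram determinant of two vectors for the form |a|² - |b|² of signature (1, 1) is minus the
squared modulus of their determinant. With `a₁ = a₂ = 1` this is the usual identity for disc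
automorphisms. -/
theorem norm_cross_sq (a₁ a₂ b₁ b₂ : ℂ) :
    ‖b₁ * a₂ - b₂ * a₁‖ ^ 2 + (‖a₁‖ ^ 2 - ‖b₁‖ ^ 2) * (‖a₂‖ ^ 2 - ‖b₂‖ ^ 2) =
      ‖conj a₁ * a₂ - conj b₁ * b₂‖ ^ 2 := by
  apply Complex.ofReal_injective
  push_cast
  simp only [← Complex.mul_conj']
  simp only [map_sub, map_mul, Complex.conj_conj]
  ring

theorem cross_ne_zero {a₁ a₂ b₁ b₂ : ℂ} (h₁ : ‖b₁‖ < ‖a₁‖) (h₂ : ‖b₂‖ < ‖a₂‖) :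
    conj a₁ * a₂ - conj b₁ * b₂ ≠ 0 := by
  intro h
  have h3 : ‖a₁‖ * ‖a₂‖ = ‖b₁‖ * ‖b₂‖ := by
    have := congrArg norm (sub_eq_zero.mp h)
    simpa using this
  have : ‖b₁‖ * ‖b₂‖ < ‖a₁‖ * ‖a₂‖ :=
    mul_lt_mul'' h₁ h₂ (norm_nonneg _) (norm_nonneg _)
  linarith

theorem one_sub_conj_mul_ne_zero {l m : ℂ} (hl : ‖l‖ < 1) (hm : ‖m‖ < 1) : 1 - conj l * m ≠ 0 := by
  have := cross_ne_zero (a₁ := 1) (a₂ := 1) (b₁ := l) (b₂ := m) (by simpa) (by simpa)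
  simpa using this

/-- Pythagorean comparison: with `x² + y = z²` and `x'² + y' = z'²`, the ratio `x / z` is at most
`x' / z'` iff `y' / z'²` is at most `y / z²`. -/
theorem div_le_div_iff_complementary {x y z x' y' z' : ℝ} (hx : 0 ≤ x) (hz : 0 < z) (hx' : 0 ≤ x')
    (hz' : 0 < z') (h : x ^ 2 + y = z ^ 2) (h' : x' ^ 2 + y' = z' ^ 2) :
    x / z ≤ x' / z' ↔ y' * z ^ 2 ≤ y * z' ^ 2 := by
  rw [div_le_div_iff₀ hz hz', ← abs_of_nonneg (mul_nonneg hx hz'.le),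
    ← abs_of_nonneg (mul_nonneg hx' hz.le), ← sq_le_sq]
  have e1 : y = z ^ 2 - x ^ 2 := by linarith
  have e2 : y' = z' ^ 2 - x' ^ 2 := by linarith
  rw [e1, e2]
  constructor <;> intro h <;> nlinarith

/-- The solvability criterion for a two-point Pick problem with values `b₁ / a₁` and `b₂ / a₂`. -/
theorem pick_two_posSemidef_iff {a₁ a₂ b₁ b₂ l m : ℂ} (h₁ : ‖b₁‖ < ‖a₁‖) (h₂ : ‖b₂‖ < ‖a₂‖)
    (hl : ‖l‖ < 1) (hm : ‖m‖ < 1) :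
    (!![(conj a₁ * a₁ - conj b₁ * b₁) / (1 - conj l * l),
        (conj a₁ * a₂ - conj b₁ * b₂) / (1 - conj l * m);
        (conj a₂ * a₁ - conj b₂ * b₁) / (1 - conj m * l),
        (conj a₂ * a₂ - conj b₂ * b₂) / (1 - conj m * m)]).PosSemidef ↔
      ‖b₁ * a₂ - b₂ * a₁‖ / ‖conj a₁ * a₂ - conj b₁ * b₂‖ ≤ ‖l - m‖ / ‖1 - conj l * m‖ := by
  have hl' : 0 < 1 - ‖l‖ ^ 2 := by nlinarith [norm_nonneg l]
  have hm' : 0 < 1 - ‖m‖ ^ 2 := by nlinarith [norm_nonneg m]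
  have e1 : (conj a₁ * a₁ - conj b₁ * b₁) / (1 - conj l * l) =
      (((‖a₁‖ ^ 2 - ‖b₁‖ ^ 2) / (1 - ‖l‖ ^ 2) : ℝ) : ℂ) := by
    push_cast; simp only [← Complex.conj_mul']
  have e2 : (conj a₂ * a₂ - conj b₂ * b₂) / (1 - conj m * m) =
      (((‖a₂‖ ^ 2 - ‖b₂‖ ^ 2) / (1 - ‖m‖ ^ 2) : ℝ) : ℂ) := by
    push_cast; simp only [← Complex.conj_mul']
  have e3 : (conj a₂ * a₁ - conj b₂ * b₁) / (1 - conj m * l) =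
      conj ((conj a₁ * a₂ - conj b₁ * b₂) / (1 - conj l * m)) := by
    simp; ring_nf
  have p1 : 0 < ‖a₁‖ ^ 2 - ‖b₁‖ ^ 2 := by nlinarith [norm_nonneg b₁]
  have q : 0 < ‖conj a₁ * a₂ - conj b₁ * b₂‖ := norm_pos_iff.mpr (cross_ne_zero h₁ h₂)
  have r : 0 < ‖1 - conj l * m‖ := norm_pos_iff.mpr (one_sub_conj_mul_ne_zero hl hm)
  have c1 := norm_cross_sq a₁ a₂ b₁ b₂
  have c2 := norm_cross_sq 1 1 l m
  simp only [mul_one, map_one, norm_one, one_pow] at c2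
  rw [e1, e2, e3, posSemidef_two_iff (by positivity),
    div_le_div_iff_complementary (norm_nonneg _) q (norm_nonneg _) r c1 c2, norm_div, div_pow,
    div_mul_div_comm, div_le_div_iff₀ (by positivity) (by positivity)]
  constructor <;> intro h <;> linarith

theorem norm_mobius_lt_one {a z : ℂ} (ha : ‖a‖ < 1) (hz : ‖z‖ < 1) :
    ‖(z - a) / (1 - conj a * z)‖ < 1 := by
  rw [norm_div, div_lt_one (norm_pos_iff.mpr (one_sub_conj_mul_ne_zero ha hz))]
  have c := norm_cross_sq 1 1 a z
  simp only [mul_one, map_one, norm_one, one_pow] at c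
  have h1 : 0 < 1 - ‖a‖ ^ 2 := by nlinarith [norm_nonneg a]
  have h2 : 0 < 1 - ‖z‖ ^ 2 := by nlinarith [norm_nonneg z]
  rw [norm_sub_rev]
  apply lt_of_pow_lt_pow_left₀ 2 (norm_nonneg _)
  nlinarith [mul_pos h1 h2]

/-- Schwarz–Pick: holomorphic self-maps of the disc contract the pseudohyperbolic distance. -/
theorem schwarz_pick {f : ℂ → ℂ} (hf : DifferentiableOn ℂ f (Metric.ball 0 1))
    (hmap : ∀ z ∈ Metric.ball (0 : ℂ) 1, ‖f z‖ < 1) {l m : ℂ} (hl : ‖l‖ < 1) (hm : ‖m‖ < 1) :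
    ‖(f l - f m) / (1 - conj (f m) * f l)‖ ≤ ‖(l - m) / (1 - conj m * l)‖ := by
  have ball : ∀ {z : ℂ}, z ∈ Metric.ball (0 : ℂ) 1 ↔ ‖z‖ < 1 := by simp
  have hm' : ‖-m‖ < 1 := by simpa
  -- `u` sends 0 to `m` and `v` sends `f m` to 0, so the Schwarz lemma applies to `v ∘ f ∘ u`.
  set u : ℂ → ℂ := fun z => (z - -m) / (1 - conj (-m) * z) with hu
  set v : ℂ → ℂ := fun z => (z - f m) / (1 - conj (f m) * z) with hv
  have hfm : ‖f m‖ < 1 := hmap m (ball.mpr hm)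
  have hud : DifferentiableOn ℂ u (Metric.ball 0 1) := by
    refine DifferentiableOn.div (by fun_prop) (by fun_prop) fun z hz => ?_
    exact one_sub_conj_mul_ne_zero hm' (ball.mp hz)
  have hvd : DifferentiableOn ℂ v (Metric.ball 0 1) := by
    refine DifferentiableOn.div (by fun_prop) (by fun_prop) fun z hz => ?_
    exact one_sub_conj_mul_ne_zero hfm (ball.mp hz)
  have hum : Set.MapsTo u (Metric.ball 0 1) (Metric.ball 0 1) := fun z hz =>
    ball.mpr (norm_mobius_lt_one hm' (ball.mp hz))
  have hcomp : DifferentiableOn ℂ (v ∘ f ∘ u) (Metric.ball 0 1) :=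
    hvd.comp (hf.comp hud hum) fun z hz => ball.mpr (hmap _ (hum hz))
  have hcm : Set.MapsTo (v ∘ f ∘ u) (Metric.ball 0 1) (Metric.ball 0 1) := fun z hz =>
    ball.mpr (norm_mobius_lt_one hfm (hmap _ (hum hz)))
  have h0 : (v ∘ f ∘ u) 0 = 0 := by simp [u, v]
  have key := norm_le_norm_of_mapsTo_ball hcomp (hcm.mono_right Metric.ball_subset_closedBall) h0 (norm_mobius_lt_one hm hl)
  have hul : u ((l - m) / (1 - conj m * l)) = l := by
    have n1 := one_sub_conj_mul_ne_zero hm hl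
    have n2 := one_sub_conj_mul_ne_zero hm hm
    have n3 : 1 + conj m * ((l - m) / (1 - conj m * l)) ≠ 0 := by
      have := one_sub_conj_mul_ne_zero hm' (norm_mobius_lt_one hm hl)
      simpa using this
    simp only [u, map_neg, neg_mul, sub_neg_eq_add]
    rw [div_eq_iff n3]
    generalize conj m = c at n1 ⊢
    have n1' : 1 - l * c ≠ 0 := by rwa [mul_comm]
    field_simp
    ring
  simp only [Function.comp, hul] at key
  exact key

/-! ### Spectral radius and the symmetrized bidisc. -/

/-- The open symmetrized bidisc. -/
def InSymBidisc (s p : ℂ) : Prop := ∃ z w : ℂ, ‖z‖ < 1 ∧ ‖w‖ < 1 ∧ s = z + w ∧ p = z * w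

/-- The closed symmetrized bidisc. -/
def InClosedSymBidisc (s p : ℂ) : Prop := ∃ z w : ℂ, ‖z‖ ≤ 1 ∧ ‖w‖ ≤ 1 ∧ s = z + w ∧ p = z * w

theorem InSymBidisc.closed {s p : ℂ} (h : InSymBidisc s p) : InClosedSymBidisc s p := by
  obtain ⟨z, w, hz, hw, hs, hp⟩ := h
  exact ⟨z, w, hz.le, hw.le, hs, hp⟩

theorem exists_sum_prod (s p : ℂ) : ∃ z w : ℂ, s = z + w ∧ p = z * w := by
  obtain ⟨d, hd⟩ := IsAlgClosed.exists_eq_mul_self (s ^ 2 - 4 * p)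
  exact ⟨(s + d) / 2, (s - d) / 2, by ring, by linear_combination (-1 / 4 : ℂ) * hd⟩

theorem mem_spectrum_two_iff (A : Matrix (Fin 2) (Fin 2) ℂ) (z : ℂ) :
    z ∈ spectrum ℂ A ↔ z ^ 2 - A.trace * z + A.det = 0 := by
  have h : (algebraMap ℂ (Matrix (Fin 2) (Fin 2) ℂ) z - A).det = z ^ 2 - A.trace * z + A.det := by
    simp [Matrix.det_fin_two, Matrix.trace_fin_two, Matrix.algebraMap_matrix_apply]
    ring
  rw [spectrum.mem_iff, Matrix.isUnit_iff_isUnit_det, isUnit_iff_ne_zero, not_not, h]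

theorem norm_le_spectralRadius_of_mem {A : Matrix (Fin 2) (Fin 2) ℂ} {z : ℂ}
    (hz : z ∈ spectrum ℂ A) : ENNReal.ofReal ‖z‖ ≤ spectralRadius ℂ A := by
  rw [ofReal_norm]
  exact le_iSup₂ (f := fun k (_ : k ∈ spectrum ℂ A) => (‖k‖₊ : ENNReal)) z hz

theorem inSymBidisc_of_spectralRadius_lt {A : Matrix (Fin 2) (Fin 2) ℂ}
    (h : spectralRadius ℂ A < 1) : InSymBidisc A.trace A.det := by
  obtain ⟨z, w, hs, hp⟩ := exists_sum_prod A.trace A.det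
  have key : ∀ x ∈ spectrum ℂ A, ‖x‖ < 1 := fun x hx => by
    rw [← ENNReal.ofReal_lt_one]; exact (norm_le_spectralRadius_of_mem hx).trans_lt h
  refine ⟨z, w, key z ?_, key w ?_, hs, hp⟩ <;> rw [mem_spectrum_two_iff, hs, hp] <;> ring

/-- The eigenvalues are the roots of X² - (tr A)X + det A. This turns the matrix problem into one
about pairs. -/
theorem spectralRadius_le_one_iff (A : Matrix (Fin 2) (Fin 2) ℂ) :
    spectralRadius ℂ A ≤ 1 ↔ InClosedSymBidisc A.trace A.det := by
  constructor
  · intro h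
    obtain ⟨z, w, hs, hp⟩ := exists_sum_prod A.trace A.det
    have key : ∀ x ∈ spectrum ℂ A, ‖x‖ ≤ 1 := fun x hx => by
      rw [← ENNReal.ofReal_le_one]; exact (norm_le_spectralRadius_of_mem hx).trans h
    refine ⟨z, w, key z ?_, key w ?_, hs, hp⟩ <;> rw [mem_spectrum_two_iff, hs, hp] <;> ring
  · rintro ⟨z, w, hz, hw, hs, hp⟩
    refine iSup₂_le fun x hx => ?_
    rw [mem_spectrum_two_iff, hs, hp] at hx
    have hx' : (x - z) * (x - w) = 0 := by linear_combination hx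
    rcases mul_eq_zero.mp hx' with h | h
    · rw [sub_eq_zero.mp h]; exact_mod_cast hz
    · rw [sub_eq_zero.mp h]; exact_mod_cast hw

/-- The right side is visibly nonnegative on the closed bidisc, which is why Φ_ω has modulus at most
1. -/
theorem norm_sq_sub_norm_sq_eq (z w : ℂ) {ω : ℂ} (hω : ‖ω‖ = 1) :
    ‖2 - ω * (z + w)‖ ^ 2 - ‖2 * ω * (z * w) - (z + w)‖ ^ 2 =
      2 * (‖1 - ω * z‖ ^ 2 * (1 - ‖w‖ ^ 2) + ‖1 - ω * w‖ ^ 2 * (1 - ‖z‖ ^ 2)) := by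
  have h : conj ω * ω = 1 := by rw [Complex.conj_mul', hω]; simp
  apply Complex.ofReal_injective
  push_cast
  simp only [← Complex.conj_mul', map_sub, map_mul, map_add, map_one, map_ofNat]
  generalize conj ω = o at h ⊢
  generalize conj z = a
  generalize conj w = b
  linear_combination (a * w + b * z - a * z - b * w) * h

theorem InSymBidisc.norm_lt {s p ω : ℂ} (h : InSymBidisc s p) (hω : ‖ω‖ = 1) :
    ‖2 * ω * p - s‖ < ‖2 - ω * s‖ := by
  obtain ⟨z, w, hz, hw, rfl, rfl⟩ := h
  have key := norm_sq_sub_norm_sq_eq z w hω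
  have h1 : 0 < 1 - ‖z‖ ^ 2 := by nlinarith [norm_nonneg z]
  have h2 : 0 < 1 - ‖w‖ ^ 2 := by nlinarith [norm_nonneg w]
  have h3 : 0 < ‖1 - ω * z‖ := by
    rw [norm_pos_iff]
    intro h
    have : ‖ω * z‖ = 1 := by rw [← sub_eq_zero.mp h, norm_one]
    rw [norm_mul, hω] at this
    linarith
  apply lt_of_pow_lt_pow_left₀ 2 (norm_nonneg _)
  have : 0 < ‖1 - ω * z‖ ^ 2 * (1 - ‖w‖ ^ 2) := by positivity
  have : 0 ≤ ‖1 - ω * w‖ ^ 2 * (1 - ‖z‖ ^ 2) := by positivity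
  linarith

theorem InClosedSymBidisc.norm_le {s p ω : ℂ} (h : InClosedSymBidisc s p) (hω : ‖ω‖ = 1) :
    ‖2 * ω * p - s‖ ≤ ‖2 - ω * s‖ := by
  obtain ⟨z, w, hz, hw, rfl, rfl⟩ := h
  have key := norm_sq_sub_norm_sq_eq z w hω
  have h1 : 0 ≤ 1 - ‖z‖ ^ 2 := by nlinarith [norm_nonneg z]
  have h2 : 0 ≤ 1 - ‖w‖ ^ 2 := by nlinarith [norm_nonneg w]
  apply le_of_sq_le_sq _ (norm_nonneg _)
  have : 0 ≤ ‖1 - ω * z‖ ^ 2 * (1 - ‖w‖ ^ 2) := by positivity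
  have : 0 ≤ ‖1 - ω * w‖ ^ 2 * (1 - ‖z‖ ^ 2) := by positivity
  linarith

/-! ### The ratio as a pseudohyperbolic distance. -/

theorem cross_eq_ratioNum (s₁ p₁ s₂ p₂ ω : ℂ) :
    (2 * ω * p₁ - s₁) * (2 - ω * s₂) - (2 * ω * p₂ - s₂) * (2 - ω * s₁) =
      -2 * ratioNum s₁ p₁ s₂ p₂ ω := by
  unfold ratioNum; ring

theorem cross_eq_ratioDen (s₁ p₁ s₂ p₂ : ℂ) {ω : ℂ} (hω : ‖ω‖ = 1) :
    conj (2 - ω * s₂) * (2 - ω * s₁) - conj (2 * ω * p₂ - s₂) * (2 * ω * p₁ - s₁) =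
      -2 * conj ω * ratioDen s₁ p₁ s₂ p₂ ω := by
  have h : conj ω * ω = 1 := by rw [Complex.conj_mul', hω]; simp
  unfold ratioDen
  simp only [map_sub, map_mul, map_ofNat]
  generalize conj ω = o at h ⊢
  linear_combination (-4 + 4 * p₁ * conj p₂ + 2 * ω * s₁ - 2 * ω * conj s₂ * p₁ + conj s₂ * s₁ - 4 * conj p₂ * p₁) * h

/-- Numerator and denominator differ from the cross terms of Φ_ω by factors -2 and -2 conj ω, of
equal modulus. -/
theorem norm_ratio (s₁ p₁ s₂ p₂ : ℂ) {ω : ℂ} (hω : ‖ω‖ = 1) :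
    ‖ratioNum s₁ p₁ s₂ p₂ ω / ratioDen s₁ p₁ s₂ p₂ ω‖ =
      ‖(2 * ω * p₁ - s₁) * (2 - ω * s₂) - (2 * ω * p₂ - s₂) * (2 - ω * s₁)‖ /
      ‖conj (2 - ω * s₁) * (2 - ω * s₂) - conj (2 * ω * p₁ - s₁) * (2 * ω * p₂ - s₂)‖ := by
  have e : ‖conj (2 - ω * s₁) * (2 - ω * s₂) - conj (2 * ω * p₁ - s₁) * (2 * ω * p₂ - s₂)‖ =
      ‖conj (2 - ω * s₂) * (2 - ω * s₁) - conj (2 * ω * p₂ - s₂) * (2 * ω * p₁ - s₁)‖ := by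
    rw [← Complex.norm_conj, map_sub, map_mul, map_mul, conj_conj, conj_conj]
    ring_nf
  rw [e, cross_eq_ratioDen _ _ _ _ hω, cross_eq_ratioNum, norm_div]
  simp only [norm_mul, Complex.norm_conj, hω, mul_one, norm_neg]
  rw [mul_div_mul_left _ _ (by simp)]

theorem ratioDen_ne_zero {s₁ p₁ s₂ p₂ ω : ℂ} (h₁ : InSymBidisc s₁ p₁) (h₂ : InSymBidisc s₂ p₂)
    (hω : ‖ω‖ = 1) : ratioDen s₁ p₁ s₂ p₂ ω ≠ 0 := by
  intro h
  have := cross_ne_zero (h₂.norm_lt hω) (h₁.norm_lt hω)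
  rw [cross_eq_ratioDen _ _ _ _ hω, h, mul_zero] at this
  exact this rfl

theorem pickMatrix_posSemidef_iff {s₁ p₁ s₂ p₂ ω l m : ℂ} (h₁ : InSymBidisc s₁ p₁)
    (h₂ : InSymBidisc s₂ p₂) (hω : ‖ω‖ = 1) (hl : ‖l‖ < 1) (hm : ‖m‖ < 1) :
    (pickMatrix ![l, m] ![s₁, s₂] ![p₁, p₂] ω).PosSemidef ↔
      ‖ratioNum s₁ p₁ s₂ p₂ ω / ratioDen s₁ p₁ s₂ p₂ ω‖ ≤ pseudohyperbolicDist l m := by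
  have e : pseudohyperbolicDist l m = ‖l - m‖ / ‖1 - conj l * m‖ := by
    rw [pseudohyperbolicDist, norm_div, ← Complex.norm_conj (1 - conj m * l)]
    simp [mul_comm]
  rw [e, norm_ratio _ _ _ _ hω, ← pick_two_posSemidef_iff (h₁.norm_lt hω) (h₂.norm_lt hω) hl hm]
  refine iff_of_eq (congrArg _ ?_)
  ext i j
  fin_cases i <;> fin_cases j <;> rfl

theorem exists_isGreatest_ratio_iff {s₁ p₁ s₂ p₂ : ℂ} (h₁ : InSymBidisc s₁ p₁)
    (h₂ : InSymBidisc s₂ p₂) (r : ℝ) :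
    (∃ M : ℝ, IsGreatest
      ((fun ω => ‖ratioNum s₁ p₁ s₂ p₂ ω / ratioDen s₁ p₁ s₂ p₂ ω‖) '' unitCircle) M ∧ M ≤ r) ↔
    ∀ ω ∈ unitCircle, ‖ratioNum s₁ p₁ s₂ p₂ ω / ratioDen s₁ p₁ s₂ p₂ ω‖ ≤ r := by
  constructor
  · rintro ⟨M, hM, hr⟩ ω hω
    exact (hM.2 ⟨ω, hω, rfl⟩).trans hr
  · intro h
    have hc : ContinuousOn (fun ω => ‖ratioNum s₁ p₁ s₂ p₂ ω / ratioDen s₁ p₁ s₂ p₂ ω‖)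
        unitCircle := by
      refine ContinuousOn.norm (ContinuousOn.div ?_ ?_ fun ω hω => ?_)
      · unfold ratioNum; fun_prop
      · unfold ratioDen; fun_prop
      · exact ratioDen_ne_zero h₁ h₂ (by simpa [unitCircle] using hω)
    obtain ⟨ω, hω, hmax⟩ := (isCompact_sphere (0 : ℂ) 1).exists_isMaxOn ⟨1, by simp⟩ hc
    refine ⟨_, ⟨⟨ω, hω, rfl⟩, ?_⟩, h ω hω⟩
    rintro _ ⟨x, hx, rfl⟩
    exact hmax hx

theorem norm_pseudohyperbolic_div {a₁ a₂ : ℂ} (b₁ b₂ : ℂ) (h₁ : a₁ ≠ 0) (h₂ : a₂ ≠ 0) :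
    ‖(b₁ / a₁ - b₂ / a₂) / (1 - conj (b₂ / a₂) * (b₁ / a₁))‖ =
      ‖b₁ * a₂ - b₂ * a₁‖ / ‖conj a₁ * a₂ - conj b₁ * b₂‖ := by
  have h₂' : conj a₂ ≠ 0 := (map_ne_zero _).mpr h₂
  have e₁ : b₁ / a₁ - b₂ / a₂ = (b₁ * a₂ - b₂ * a₁) / (a₁ * a₂) := by
    field_simp
  have e₂ : 1 - conj (b₂ / a₂) * (b₁ / a₁) =
      conj (conj a₁ * a₂ - conj b₁ * b₂) / (a₁ * conj a₂) := by
    simp only [map_sub, map_mul, map_div₀, conj_conj]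
    field_simp
  rw [e₁, e₂, norm_div, norm_div, norm_div, Complex.norm_conj]
  simp only [norm_mul, Complex.norm_conj]
  rw [div_div_div_cancel_right₀ (mul_ne_zero (norm_ne_zero_iff.mpr h₁) (norm_ne_zero_iff.mpr h₂))]

/-- The ratios of an analytic disc in the closed symmetrized bidisc obey the Schwarz–Pick bound. -/
theorem ratio_le_of_analytic {s p : ℂ → ℂ} (hs : AnalyticOnNhd ℂ s (Metric.ball 0 1))
    (hp : AnalyticOnNhd ℂ p (Metric.ball 0 1))
    (hG : ∀ z ∈ Metric.ball (0 : ℂ) 1, InClosedSymBidisc (s z) (p z)) {l m : ℂ} (hl : ‖l‖ < 1)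
    (hm : ‖m‖ < 1) (hl' : InSymBidisc (s l) (p l)) {ω : ℂ} (hω : ‖ω‖ = 1) :
    ‖ratioNum (s l) (p l) (s m) (p m) ω / ratioDen (s l) (p l) (s m) (p m) ω‖ ≤
      pseudohyperbolicDist l m := by
  have hlb : l ∈ Metric.ball (0 : ℂ) 1 := by simpa
  have hmb : m ∈ Metric.ball (0 : ℂ) 1 := by simpa
  -- Maximum modulus: strictness at `l` spreads to the whole disc. It is used for `s`, so that 2 -
  -- ωs has no zero, and then for `f`.
  have strict : ∀ {g : ℂ → ℂ} {r : ℝ}, DifferentiableOn ℂ g (Metric.ball 0 1) →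
      (∀ z ∈ Metric.ball (0 : ℂ) 1, ‖g z‖ ≤ r) → ‖g l‖ < r →
      ∀ z ∈ Metric.ball (0 : ℂ) 1, ‖g z‖ < r := by
    intro g r hg hle hlt z hz
    refine lt_of_le_of_ne (hle z hz) fun heq => hlt.ne ?_
    have := norm_eqOn_of_isPreconnected_of_isMaxOn (convex_ball (0 : ℂ) 1).isPreconnected
      Metric.isOpen_ball hg hz (fun x hx => by simpa [heq] using hle x hx) hlb
    simpa [heq] using this
  have hs2 : ∀ z ∈ Metric.ball (0 : ℂ) 1, ‖s z‖ < 2 := by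
    refine strict hs.differentiableOn (fun z hz => ?_) ?_
    · obtain ⟨a, b, ha, hb, h, -⟩ := hG z hz
      rw [h]; exact (norm_add_le _ _).trans (by linarith)
    · obtain ⟨a, b, ha, hb, h, -⟩ := hl'
      rw [h]; exact (norm_add_le _ _).trans_lt (by linarith)
  have hne : ∀ z ∈ Metric.ball (0 : ℂ) 1, 2 - ω * s z ≠ 0 := by
    intro z hz h
    have : ‖ω * s z‖ = 2 := by rw [← sub_eq_zero.mp h]; simp
    rw [norm_mul, hω, one_mul] at this
    linarith [hs2 z hz]
  set f : ℂ → ℂ := fun z => (2 * ω * p z - s z) / (2 - ω * s z) with hf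
  have hfd : DifferentiableOn ℂ f (Metric.ball 0 1) := by
    have := hs.differentiableOn
    have := hp.differentiableOn
    exact DifferentiableOn.div (by fun_prop) (by fun_prop) hne
  have hf1 : ∀ z ∈ Metric.ball (0 : ℂ) 1, ‖f z‖ < 1 := by
    refine strict hfd (fun z hz => ?_) ?_
    · rw [hf, norm_div]
      exact div_le_one_of_le₀ ((hG z hz).norm_le hω) (norm_nonneg _)
    · rw [hf, norm_div, div_lt_one (norm_pos_iff.mpr (hne l hlb))]
      exact hl'.norm_lt hω
  have key := schwarz_pick hfd hf1 hl hm
  refine le_trans (le_of_eq ?_) key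
  rw [norm_ratio _ _ _ _ hω]
  have n1 := hne l hlb
  have n2 := hne m hmb
  exact (norm_pseudohyperbolic_div _ _ n1 n2).symm

/-! ### Positivity on the half-plane and the quadratic. -/

/-- The sesquilinear form whose Pick-type kernel describes the half-plane model. -/
def halfPlaneForm (t₁ w₁ t₂ w₂ : ℂ) : ℂ :=
  conj t₁ * t₂ * (conj t₁ + t₂) - conj t₁ * w₂ - conj w₁ * t₂

theorem slope_eq_zero_of_affine_nonneg {a b : ℝ} (h : ∀ x : ℝ, 0 ≤ a + b * x) : b = 0 := by
  by_contra hb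
  have := h ((-1 - a) / b)
  rw [mul_div_cancel₀ _ hb] at this
  linarith

/-- AM–GM. It replaces the determinant condition by one linear in the matrix entries, at the cost of
sharpness. -/
theorem two_mul_re_le {z : ℂ} {x y : ℝ} (hx : 0 ≤ x) (hy : 0 ≤ y) (h : ‖z‖ ^ 2 ≤ x * y) :
    2 * z.re ≤ x + y := by
  have h1 : z.re ^ 2 ≤ ‖z‖ ^ 2 := by
    rw [← Complex.normSq_eq_norm_sq, Complex.normSq_apply]
    nlinarith [mul_self_nonneg z.im]
  refine (abs_le_of_sq_le_sq' ?_ (by positivity)).2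
  nlinarith [sq_nonneg (x - y)]

/-- Interpolation by a quadratic polynomial that is real on the imaginary axis. -/
theorem exists_real_quadratic {A₁ A₂ B₁ B₂ n₁ n₂ m₁ m₂ : ℝ} (h₁ : 0 < A₁) (h₂ : 0 < A₂)
    (hne : ¬(A₁ = A₂ ∧ B₁ = B₂))
    (h : (m₂ - m₁) * (A₂ ^ 2 - A₁ ^ 2) =
      (m₁ + m₂) * (B₂ - B₁) ^ 2 + 2 * (n₂ - n₁) * (B₂ - B₁)) :
    ∃ α β γ : ℝ, n₁ = α * (A₁ ^ 2 - B₁ ^ 2) - β * B₁ + γ ∧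
      n₂ = α * (A₂ ^ 2 - B₂ ^ 2) - β * B₂ + γ ∧ m₁ = 2 * α * B₁ + β ∧ m₂ = 2 * α * B₂ + β := by
  -- The equations at index 1 fix β and γ. Two equations remain for α, and `h` is their
  -- compatibility; if `B₁ = B₂`, α comes from the second.
  suffices ∃ α : ℝ, m₂ - m₁ = 2 * α * (B₂ - B₁) ∧
      n₂ - n₁ = α * (A₂ ^ 2 - B₂ ^ 2 - A₁ ^ 2 + B₁ ^ 2) - (m₁ - 2 * α * B₁) * (B₂ - B₁) by
    obtain ⟨α, ha, hb⟩ := this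
    exact ⟨α, m₁ - 2 * α * B₁, n₁ - α * (A₁ ^ 2 - B₁ ^ 2) + (m₁ - 2 * α * B₁) * B₁,
      by ring, by linarith, by ring, by linarith⟩
  by_cases hB : B₁ = B₂
  · subst hB
    have hA : A₂ ^ 2 - A₁ ^ 2 ≠ 0 := fun h0 => hne ⟨by nlinarith, rfl⟩
    refine ⟨(n₂ - n₁) / (A₂ ^ 2 - A₁ ^ 2), ?_, ?_⟩
    · have : (m₂ - m₁) * (A₂ ^ 2 - A₁ ^ 2) = 0 := by rw [h]; ring
      rcases mul_eq_zero.mp this with h0 | h0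
      · rw [h0]; ring
      · exact absurd h0 hA
    · field_simp; ring
  · have hd : B₂ - B₁ ≠ 0 := sub_ne_zero.mpr (Ne.symm hB)
    refine ⟨(m₂ - m₁) / (2 * (B₂ - B₁)), by field_simp, ?_⟩
    apply mul_left_cancel₀ hd
    have : (m₂ - m₁) = 2 * ((m₂ - m₁) / (2 * (B₂ - B₁))) * (B₂ - B₁) := by field_simp
    set α := (m₂ - m₁) / (2 * (B₂ - B₁))
    linear_combination (1 / 2 : ℝ) * ((A₂ ^ 2 - A₁ ^ 2) - (B₂ - B₁) ^ 2) * this - (1 / 2 : ℝ) * h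

theorem halfPlaneForm_self_re (σ w : ℂ) (τ : ℝ) :
    (halfPlaneForm (σ - τ * I) w (σ - τ * I) w).re =
      (halfPlaneForm σ w σ w).re + (2 * w.im - 4 * σ.re * σ.im) * τ + 2 * σ.re * τ ^ 2 := by
  simp [halfPlaneForm]
  ring

theorem halfPlaneForm_shift (σ₁ w₁ σ₂ w₂ : ℂ) (τ : ℝ) :
    halfPlaneForm (σ₁ - τ * I) w₁ (σ₂ - τ * I) w₂ = halfPlaneForm σ₁ w₁ σ₂ w₂ +
      τ * I * ((σ₂ - conj σ₁) * (conj σ₁ + σ₂) - (w₂ - conj w₁)) + τ ^ 2 * (conj σ₁ + σ₂) := by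
  simp only [halfPlaneForm, map_sub, map_mul, conj_I, conj_ofReal]
  linear_combination (-(τ : ℂ) ^ 2 * (conj σ₁ + σ₂)) * I_sq

/-- The tangency condition forces the data to lie on a quadratic that is real on the imaginary
axis. -/
theorem exists_quadratic_of_halfPlaneForm {σ₁ σ₂ w₁ w₂ : ℂ} (h₁ : 0 < σ₁.re) (h₂ : 0 < σ₂.re)
    (hne : σ₁ ≠ σ₂)
    (hp₁ : ∀ τ : ℝ, 0 ≤ (halfPlaneForm (σ₁ - τ * I) w₁ (σ₁ - τ * I) w₁).re)
    (hp₂ : ∀ τ : ℝ, 0 ≤ (halfPlaneForm (σ₂ - τ * I) w₂ (σ₂ - τ * I) w₂).re)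
    (hdet : ∀ τ : ℝ, ‖halfPlaneForm (σ₁ - τ * I) w₁ (σ₂ - τ * I) w₂‖ ^ 2 * (4 * σ₁.re * σ₂.re) ≤
      (halfPlaneForm (σ₁ - τ * I) w₁ (σ₁ - τ * I) w₁).re *
      (halfPlaneForm (σ₂ - τ * I) w₂ (σ₂ - τ * I) w₂).re * ‖conj σ₁ + σ₂‖ ^ 2) :
    ∃ α β γ : ℝ, w₁ = α * σ₁ ^ 2 + β * I * σ₁ + γ ∧ w₂ = α * σ₂ ^ 2 + β * I * σ₂ + γ := by
  set Z := conj σ₁ + σ₂ with hZ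
  have hZre : Z.re = σ₁.re + σ₂.re := by simp [Z]
  have hZ0 : Z ≠ 0 := fun h => by
    rw [h, zero_re] at hZre
    linarith
  have hZn : 0 < ‖Z‖ := norm_pos_iff.mpr hZ0
  -- After these normalizations every entry has τ² coefficient 1. The quadratic terms cancel,
  -- leaving an affine function of τ bounded below, whose slope must vanish.
  have hq : ∀ τ : ℝ, 2 * (halfPlaneForm (σ₁ - τ * I) w₁ (σ₂ - τ * I) w₂ / Z).re ≤
      (halfPlaneForm (σ₁ - τ * I) w₁ (σ₁ - τ * I) w₁).re / (2 * σ₁.re) +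
      (halfPlaneForm (σ₂ - τ * I) w₂ (σ₂ - τ * I) w₂).re / (2 * σ₂.re) := by
    intro τ
    refine two_mul_re_le (div_nonneg (hp₁ τ) (by positivity)) (div_nonneg (hp₂ τ) (by positivity)) ?_
    rw [norm_div, div_pow, div_mul_div_comm, div_le_div_iff₀ (by positivity) (by positivity)]
    linarith [hdet τ]
  have hslope := slope_eq_zero_of_affine_nonneg
    (a := (halfPlaneForm σ₁ w₁ σ₁ w₁).re / (2 * σ₁.re) + (halfPlaneForm σ₂ w₂ σ₂ w₂).re / (2 * σ₂.re)
      - 2 * (halfPlaneForm σ₁ w₁ σ₂ w₂ / Z).re)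
    (b := w₁.im / σ₁.re + w₂.im / σ₂.re - 2 * ((w₂ - conj w₁) / Z).im) (fun τ => by
      have e : halfPlaneForm (σ₁ - τ * I) w₁ (σ₂ - τ * I) w₂ / Z = halfPlaneForm σ₁ w₁ σ₂ w₂ / Z +
          τ * (I * ((σ₂ - conj σ₁) - (w₂ - conj w₁) / Z)) + (τ ^ 2 : ℝ) := by
        rw [halfPlaneForm_shift, ← hZ]
        push_cast
        field_simp
      have h := hq τ
      rw [e, halfPlaneForm_self_re, halfPlaneForm_self_re] at h
      simp only [add_re, re_ofReal_mul, ofReal_re, I_mul_re, sub_im, conj_im] at h ⊢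
      have f₁ : ∀ x y z A : ℝ, 0 < A → (x + (2 * y - 4 * A * z) * τ + 2 * A * τ ^ 2) / (2 * A) =
          x / (2 * A) + y / A * τ - 2 * z * τ + τ ^ 2 := by
        intro x y z A hA
        field_simp
        ring
      rw [f₁ _ _ _ _ h₁, f₁ _ _ _ _ h₂] at h
      linarith)
  have hn : ¬(σ₁.re = σ₂.re ∧ σ₁.im = σ₂.im) := fun h => hne (Complex.ext h.1 h.2)
  -- Four real equations in three unknowns; the vanishing slope times |Z|² is the missing
  -- compatibility.
  obtain ⟨α, β, γ, e₁, e₂, e₃, e₄⟩ := exists_real_quadratic (n₁ := w₁.re) (n₂ := w₂.re)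
    (m₁ := w₁.im / σ₁.re) (m₂ := w₂.im / σ₂.re) h₁ h₂ hn (by
      have hZs : Complex.normSq Z ≠ 0 := by simpa using hZ0
      have e : ((w₂ - conj w₁) / Z).im * Complex.normSq Z =
          (w₁.im + w₂.im) * (σ₁.re + σ₂.re) - (w₂.re - w₁.re) * (σ₂.im - σ₁.im) := by
        rw [Complex.div_im]
        field_simp
        simp [Z]
        ring
      have e' : Complex.normSq Z = (σ₁.re + σ₂.re) ^ 2 + (σ₂.im - σ₁.im) ^ 2 := by
        simp [Complex.normSq_apply, Z]
        ring
      have y₁ : w₁.im = w₁.im / σ₁.re * σ₁.re := by field_simp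
      have y₂ : w₂.im = w₂.im / σ₂.re * σ₂.re := by field_simp
      generalize w₁.im / σ₁.re = m₁ at *
      generalize w₂.im / σ₂.re = m₂ at *
      rw [y₁, y₂, e'] at e
      linear_combination ((σ₁.re + σ₂.re) ^ 2 + (σ₂.im - σ₁.im) ^ 2) * (-hslope) - 2 * e)
  rw [div_eq_iff h₁.ne'] at e₃
  rw [div_eq_iff h₂.ne'] at e₄
  refine ⟨α, β, γ, Complex.ext ?_ ?_, Complex.ext ?_ ?_⟩ <;> simp [pow_two] <;> linarith

/-- The sharp constraints on the quadratic coming from positivity of the half-plane form. -/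
theorem quadratic_bounds_of_halfPlaneForm {σ₁ σ₂ : ℂ} {α β γ : ℝ} (h₁ : 0 < σ₁.re)
    (h₂ : 0 < σ₂.re) (hne : σ₁ ≠ σ₂) {w₁ w₂ : ℂ} (hw₁ : w₁ = α * σ₁ ^ 2 + β * I * σ₁ + γ)
    (hw₂ : w₂ = α * σ₂ ^ 2 + β * I * σ₂ + γ)
    (hp₁ : ∀ τ : ℝ, 0 ≤ (halfPlaneForm (σ₁ - τ * I) w₁ (σ₁ - τ * I) w₁).re)
    (hp₂ : ∀ τ : ℝ, 0 ≤ (halfPlaneForm (σ₂ - τ * I) w₂ (σ₂ - τ * I) w₂).re)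
    (hdet : ∀ τ : ℝ, ‖halfPlaneForm (σ₁ - τ * I) w₁ (σ₂ - τ * I) w₂‖ ^ 2 * (4 * σ₁.re * σ₂.re) ≤
      (halfPlaneForm (σ₁ - τ * I) w₁ (σ₁ - τ * I) w₁).re *
      (halfPlaneForm (σ₂ - τ * I) w₂ (σ₂ - τ * I) w₂).re * ‖conj σ₁ + σ₂‖ ^ 2) :
    α ≤ 1 ∧ ∀ τ : ℝ, 0 ≤ α * (τ * τ) + β * τ + -γ := by
  -- On the quadratic the form is divisible by conj x + y, so the kernel to be tested is a rank-one
  -- term plus a constant.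
  have form : ∀ (x y : ℂ) (τ : ℝ), halfPlaneForm (x - τ * I) (α * x ^ 2 + β * I * x + γ)
      (y - τ * I) (α * y ^ 2 + β * I * y + γ) = (conj x + y) *
        ((1 - α) * (conj (x - τ * I) * (y - τ * I)) + (α * (τ * τ) + β * τ + -γ)) := by
    intro x y τ
    simp only [halfPlaneForm, map_sub, map_mul, map_add, map_pow, conj_I, conj_ofReal]
    ring_nf
    simp only [I_sq]
    ring
  have selfForm : ∀ (x : ℂ) (τ : ℝ), (halfPlaneForm (x - τ * I) (α * x ^ 2 + β * I * x + γ)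
      (x - τ * I) (α * x ^ 2 + β * I * x + γ)).re = 2 * x.re *
        ((1 - α) * ‖x - τ * I‖ ^ 2 + (α * (τ * τ) + β * τ + -γ)) := by
    intro x τ
    have : conj x + x = ((2 * x.re : ℝ) : ℂ) := by
      rw [add_comm, Complex.add_conj]
    rw [form, this, Complex.conj_mul', re_ofReal_mul]
    norm_cast
  subst hw₁ hw₂
  simp only [selfForm] at hp₁ hp₂ hdet
  simp only [form] at hdet
  have hZn : 0 < ‖conj σ₁ + σ₂‖ := by
    refine norm_pos_iff.mpr fun h => ?_
    have : (conj σ₁ + σ₂).re = σ₁.re + σ₂.re := by simp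
    rw [h, zero_re] at this
    linarith
  have q₁ : ∀ τ : ℝ, 0 ≤ (1 - α) * ‖σ₁ - τ * I‖ ^ 2 + (α * (τ * τ) + β * τ + -γ) := fun τ =>
    nonneg_of_mul_nonneg_right (hp₁ τ) (by positivity)
  have q₂ : ∀ τ : ℝ, 0 ≤ (1 - α) * ‖σ₂ - τ * I‖ ^ 2 + (α * (τ * τ) + β * τ + -γ) := fun τ =>
    nonneg_of_mul_nonneg_right (hp₂ τ) (by positivity)
  have q₃ : ∀ τ : ℝ, ‖(1 - α) * (conj (σ₁ - τ * I) * (σ₂ - τ * I)) +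
      (α * (τ * τ) + β * τ + -γ : ℂ)‖ ^ 2 ≤
      ((1 - α) * ‖σ₁ - τ * I‖ ^ 2 + (α * (τ * τ) + β * τ + -γ)) *
      ((1 - α) * ‖σ₂ - τ * I‖ ^ 2 + (α * (τ * τ) + β * τ + -γ)) := fun τ => by
    have := hdet τ
    rw [norm_mul, mul_pow] at this
    refine le_of_mul_le_mul_left ?_ (show 0 < ‖conj σ₁ + σ₂‖ ^ 2 * (4 * σ₁.re * σ₂.re) by positivity)
    linarith
  have hd : 0 < ‖σ₁ - σ₂‖ ^ 2 := by
    have := norm_pos_iff.mpr (sub_ne_zero.mpr hne)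
    positivity
  have dist : ∀ τ : ℝ, ‖σ₁ - σ₂‖ ^ 2 = ‖σ₁ - τ * I‖ ^ 2 + ‖σ₂ - τ * I‖ ^ 2 -
      2 * (conj (σ₁ - τ * I) * (σ₂ - τ * I)).re := by
    intro τ
    simp only [← Complex.normSq_eq_norm_sq, Complex.normSq_apply]
    simp
    ring
  have e : ∀ (z : ℂ) (τ : ℝ), (1 - α) * z + (α * (τ * τ) + β * τ + -γ : ℂ) =
      ((1 - α : ℝ) : ℂ) * z + ((α * (τ * τ) + β * τ + -γ : ℝ) : ℂ) := by
    intro z τ; push_cast; ring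
  have ha : α ≤ 1 := by
    have := two_mul_re_le (q₁ 0) (q₂ 0) (q₃ 0)
    have d := dist 0
    rw [e, add_re, re_ofReal_mul, ofReal_re] at this
    have : 0 ≤ (1 - α) * ‖σ₁ - σ₂‖ ^ 2 := by rw [d]; linarith
    linarith [nonneg_of_mul_nonneg_left this hd]
  refine ⟨ha, fun τ => ?_⟩
  have d := dist τ
  have h3 := q₃ τ
  have h1 := q₁ τ
  rw [e] at h3
  generalize α * (τ * τ) + β * τ + -γ = b at *
  -- For α < 1 the determinant of the kernel is (1 - α) b |σ₁ - σ₂|²; for α = 1 a diagonal entry is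
  -- already b.
  rcases ha.eq_or_lt with rfl | ha
  · simpa using h1
  · have hz : ‖conj (σ₁ - τ * I) * (σ₂ - τ * I)‖ = ‖σ₁ - τ * I‖ * ‖σ₂ - τ * I‖ := by
      rw [norm_mul, Complex.norm_conj]
    have hexp : ∀ (z : ℂ) (a b : ℝ), ‖(a : ℂ) * z + b‖ ^ 2 =
        a ^ 2 * ‖z‖ ^ 2 + 2 * a * b * z.re + b ^ 2 := by
      intro z a b
      simp only [← Complex.normSq_eq_norm_sq, Complex.normSq_apply]
      simp
      ring
    rw [hexp, hz] at h3
    have : 0 ≤ (1 - α) * ‖σ₁ - σ₂‖ ^ 2 * b := by rw [d]; linarith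
    exact nonneg_of_mul_nonneg_right this (by have : 0 < 1 - α := by linarith
                                              positivity)

/-- Above every point of the right half-plane the quadratic stays in the symmetrized half-plane. -/
theorem re_nonneg_of_sq_eq_quadratic {α β γ : ℝ} (hα : α ≤ 1)
    (hq : ∀ τ : ℝ, 0 ≤ α * (τ * τ) + β * τ + -γ) {σ δ : ℂ} (hσ : 0 < σ.re)
    (h : δ ^ 2 = α * σ ^ 2 + β * I * σ + γ) : 0 ≤ (σ + δ).re := by
  have hdisc := discrim_le_zero hq
  rw [discrim] at hdisc
  have hre := congrArg re h
  have him := congrArg im h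
  simp [pow_two] at hre him
  rw [add_re]
  -- With q the quadratic in `hq`, `hdisc` gives (α Im σ + β/2)² ≤ α q(Im σ). The last factor in
  -- `h3` is then at most -(1 - α)((Re σ)² + q(Im σ)) ≤ 0, contradicting `h1`.
  by_contra! hlt
  have hx : 0 < δ.re ^ 2 - σ.re ^ 2 := by nlinarith
  have hb := mul_nonneg (sub_nonneg.mpr hα) (hq σ.im)
  have h1 : 0 < (δ.re ^ 2 - σ.re ^ 2) * (σ.re ^ 2 + δ.im ^ 2) := by positivity
  have h2 : δ.re * δ.im = σ.re * (α * σ.im + β / 2) := by linarith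
  have h3 : (δ.re ^ 2 - σ.re ^ 2) * (σ.re ^ 2 + δ.im ^ 2) = σ.re ^ 2 *
      ((δ.re * δ.re - δ.im * δ.im) + (α * σ.im + β / 2) ^ 2 - σ.re ^ 2) := by
    linear_combination (δ.re * δ.im + σ.re * (α * σ.im + β / 2)) * h2
  rw [h3, hre] at h1
  have h4 := pos_of_mul_pos_right h1 (by positivity)
  nlinarith [mul_nonneg (sub_nonneg.mpr hα) (sq_nonneg σ.re)]

/-! ### Cayley transform to the right half-plane. -/

/-- The sesquilinear form whose diagonal measures the position of `(s, p)` relative to the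
functions `(2ωp - s) / (2 - ωs)`. -/
def discForm (ω s₁ p₁ s₂ p₂ : ℂ) : ℂ :=
  conj (2 - ω * s₁) * (2 - ω * s₂) - conj (2 * ω * p₁ - s₁) * (2 * ω * p₂ - s₂)

theorem discForm_self_re (ω s p : ℂ) :
    (discForm ω s p s p).re = ‖2 - ω * s‖ ^ 2 - ‖2 * ω * p - s‖ ^ 2 := by
  rw [discForm, Complex.conj_mul', Complex.conj_mul']
  norm_cast

theorem InSymBidisc.one_sub_add_ne_zero {s p : ℂ} (h : InSymBidisc s p) : 1 - s + p ≠ 0 := by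
  obtain ⟨z, w, hz, hw, rfl, rfl⟩ := h
  have key : ∀ x : ℂ, ‖x‖ < 1 → 1 - x ≠ 0 := fun x hx h => by
    rw [← sub_eq_zero.mp h, norm_one] at hx
    exact lt_irrefl _ hx
  have e : 1 - (z + w) + z * w = (1 - z) * (1 - w) := by ring
  rw [e]
  exact mul_ne_zero (key z hz) (key w hw)

/-- The mean of the Cayley transforms of the two points. -/
noncomputable def cayleyMean (s p : ℂ) : ℂ := (1 - p) / (1 - s + p)

/-- The square of half the difference of the Cayley transforms of the two points. -/
noncomputable def cayleySqDiff (s p : ℂ) : ℂ := cayleyMean s p ^ 2 - (1 + s + p) / (1 - s + p)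

/-- Here 2 - s and 2p - s are 1 - s + p times 1 + σ and 1 - σ, so Φ₁ sees only the mean σ. -/
theorem discForm_one {s₁ p₁ s₂ p₂ : ℂ} (h₁ : 1 - s₁ + p₁ ≠ 0) (h₂ : 1 - s₂ + p₂ ≠ 0) :
    discForm 1 s₁ p₁ s₂ p₂ = 2 * conj (1 - s₁ + p₁) * (1 - s₂ + p₂) *
      (conj (cayleyMean s₁ p₁) + cayleyMean s₂ p₂) := by
  have h₁' := (map_ne_zero (starRingEnd ℂ)).mpr h₁
  simp only [discForm, cayleyMean, map_sub, map_add, map_mul, map_div₀, map_one, map_ofNat]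
    at h₁' ⊢
  field_simp
  ring

theorem cross_one {s₁ p₁ s₂ p₂ : ℂ} (h₁ : 1 - s₁ + p₁ ≠ 0) (h₂ : 1 - s₂ + p₂ ≠ 0) :
    (2 * 1 * p₁ - s₁) * (2 - 1 * s₂) - (2 * 1 * p₂ - s₂) * (2 - 1 * s₁) =
      2 * (1 - s₁ + p₁) * (1 - s₂ + p₂) * (cayleyMean s₂ p₂ - cayleyMean s₁ p₁) := by
  simp only [cayleyMean]
  field_simp
  ring

/-- The Cayley parametrization of the unit circle without the point `1`. -/
noncomputable def circlePoint (τ : ℝ) : ℂ := (-τ * I - 1) / (-τ * I + 1)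

theorem neg_mul_I_add_one_ne_zero (τ : ℝ) : -τ * I + 1 ≠ 0 := fun h => by
  simpa using congrArg re h

theorem conj_neg_mul_I_add_one (τ : ℝ) : conj (-τ * I + 1) = -(-τ * I - 1) := by
  simp
  ring

theorem norm_circlePoint (τ : ℝ) : ‖circlePoint τ‖ = 1 := by
  have h : ‖-τ * I - 1‖ = ‖-τ * I + 1‖ := by
    rw [← Complex.norm_conj (-τ * I + 1), conj_neg_mul_I_add_one, norm_neg]
  rw [circlePoint, norm_div, h, div_self (norm_ne_zero_iff.mpr (neg_mul_I_add_one_ne_zero τ))]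

/-- Changing ω translates both Cayley points by -iτ: the mean shifts and the squared half-difference
stays fixed. -/
theorem discForm_circlePoint {s₁ p₁ s₂ p₂ : ℂ} (h₁ : 1 - s₁ + p₁ ≠ 0) (h₂ : 1 - s₂ + p₂ ≠ 0)
    (τ : ℝ) : discForm (circlePoint τ) s₁ p₁ s₂ p₂ =
      2 * conj (1 - s₁ + p₁) * (1 - s₂ + p₂) / ((1 + τ ^ 2 : ℝ) : ℂ) *
      halfPlaneForm (cayleyMean s₁ p₁ - τ * I) (cayleySqDiff s₁ p₁)
        (cayleyMean s₂ p₂ - τ * I) (cayleySqDiff s₂ p₂) := by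
  have h₁' := (map_ne_zero (starRingEnd ℂ)).mpr h₁
  have hc := neg_mul_I_add_one_ne_zero τ
  have hc' := (map_ne_zero (starRingEnd ℂ)).mpr hc
  have e : ((1 + τ ^ 2 : ℝ) : ℂ) = (1 - (-τ * I)) * (1 + (-τ * I)) := by
    push_cast
    linear_combination ((τ : ℂ) ^ 2) * I_sq
  have e' : ∀ x : ℂ, x - τ * I = x + (-τ * I) := fun x => by ring
  have hcc : conj (-τ * I) = -(-τ * I) := by simp
  rw [e]
  -- `map_mul` is restricted to these shapes so that conj(-τI) survives for `hcc`; then -τI can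
  -- become a free variable.
  simp only [e', discForm, halfPlaneForm, cayleySqDiff, cayleyMean, circlePoint, map_sub, map_add,
    map_mul (starRingEnd ℂ) 2, map_mul (starRingEnd ℂ) (2 * _),
    map_mul (starRingEnd ℂ) (_ / _), map_pow, map_div₀, map_one, map_ofNat, hcc] at h₁' hc' ⊢
  generalize conj s₁ = a at *
  generalize conj p₁ = b at *
  generalize -τ * I = c at *
  have hc'' : 1 - c ≠ 0 := fun h => hc' (by linear_combination h)
  have hc3 : 1 + c ≠ 0 := fun h => hc (by linear_combination h)
  field_simp
  ring

theorem norm_sq_sub_norm_sq_one {s p : ℂ} (h : 1 - s + p ≠ 0) :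
    ‖2 - 1 * s‖ ^ 2 - ‖2 * 1 * p - s‖ ^ 2 = 4 * ‖1 - s + p‖ ^ 2 * (cayleyMean s p).re := by
  rw [← discForm_self_re, discForm_one h h, mul_assoc 2, Complex.conj_mul',
    add_comm (conj _), Complex.add_conj, ← ofReal_pow, ← ofReal_ofNat, ← ofReal_mul,
    ← ofReal_mul, ofReal_re]
  ring

theorem cayleyMean_re_pos {s p : ℂ} (h : InSymBidisc s p) : 0 < (cayleyMean s p).re := by
  have hlt := h.norm_lt (ω := 1) norm_one
  have hn := h.one_sub_add_ne_zero
  have h1 : 0 < 4 * ‖1 - s + p‖ ^ 2 * (cayleyMean s p).re := by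
    rw [← norm_sq_sub_norm_sq_one hn]
    nlinarith [norm_nonneg (2 * 1 * p - s)]
  exact pos_of_mul_pos_right h1 (by positivity)

theorem norm_ratio_one {s₁ p₁ s₂ p₂ : ℂ} (h₁ : 1 - s₁ + p₁ ≠ 0) (h₂ : 1 - s₂ + p₂ ≠ 0) :
    ‖ratioNum s₁ p₁ s₂ p₂ 1 / ratioDen s₁ p₁ s₂ p₂ 1‖ =
      ‖cayleyMean s₁ p₁ - cayleyMean s₂ p₂‖ / ‖conj (cayleyMean s₁ p₁) + cayleyMean s₂ p₂‖ := by
  rw [norm_ratio _ _ _ _ norm_one, cross_one h₁ h₂]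
  have := discForm_one h₁ h₂
  rw [discForm] at this
  rw [this]
  simp only [norm_mul, Complex.norm_conj]
  rw [mul_div_mul_left _ _ (by simpa using ⟨h₁, h₂⟩), norm_sub_rev]

/-- Maximality of the ratio at `ω = 1` is positivity of the half-plane form. -/
theorem halfPlaneForm_of_isMax_one {s₁ p₁ s₂ p₂ : ℂ} (h₁ : InSymBidisc s₁ p₁)
    (h₂ : InSymBidisc s₂ p₂)
    (hmax : ∀ ω : ℂ, ‖ω‖ = 1 → ‖ratioNum s₁ p₁ s₂ p₂ ω / ratioDen s₁ p₁ s₂ p₂ ω‖ ≤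
      ‖ratioNum s₁ p₁ s₂ p₂ 1 / ratioDen s₁ p₁ s₂ p₂ 1‖) {σ₁ σ₂ w₁ w₂ : ℂ}
    (hσ₁ : σ₁ = cayleyMean s₁ p₁) (hσ₂ : σ₂ = cayleyMean s₂ p₂)
    (hw₁ : w₁ = cayleySqDiff s₁ p₁) (hw₂ : w₂ = cayleySqDiff s₂ p₂) (τ : ℝ) :
    0 ≤ (halfPlaneForm (σ₁ - τ * I) w₁ (σ₁ - τ * I) w₁).re ∧
    0 ≤ (halfPlaneForm (σ₂ - τ * I) w₂ (σ₂ - τ * I) w₂).re ∧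
    ‖halfPlaneForm (σ₁ - τ * I) w₁ (σ₂ - τ * I) w₂‖ ^ 2 * (4 * σ₁.re * σ₂.re) ≤
      (halfPlaneForm (σ₁ - τ * I) w₁ (σ₁ - τ * I) w₁).re *
      (halfPlaneForm (σ₂ - τ * I) w₂ (σ₂ - τ * I) w₂).re * ‖conj σ₁ + σ₂‖ ^ 2 := by
  have n₁ := h₁.one_sub_add_ne_zero
  have n₂ := h₂.one_sub_add_ne_zero
  have hv := norm_circlePoint τ
  have self2 : ∀ {s p : ℂ}, 1 - s + p ≠ 0 →
      ‖2 - circlePoint τ * s‖ ^ 2 - ‖2 * circlePoint τ * p - s‖ ^ 2 =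
      2 * ‖1 - s + p‖ ^ 2 / (1 + τ ^ 2) * (halfPlaneForm (cayleyMean s p - τ * I)
        (cayleySqDiff s p) (cayleyMean s p - τ * I) (cayleySqDiff s p)).re := by
    intro s p hn
    rw [← discForm_self_re, discForm_circlePoint hn hn, mul_assoc 2, Complex.conj_mul',
      ← ofReal_pow, ← ofReal_ofNat, ← ofReal_mul, ← ofReal_div, re_ofReal_mul]
  -- Passing to complements 1 - ratio² turns maximality at 1 into the determinant inequality; the
  -- factors 1 - s + p cancel.
  have hle := hmax _ hv
  rw [norm_ratio _ _ _ _ hv, norm_ratio _ _ _ _ norm_one,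
    div_le_div_iff_complementary (norm_nonneg _)
      (norm_pos_iff.mpr (cross_ne_zero (h₁.norm_lt hv) (h₂.norm_lt hv))) (norm_nonneg _)
      (norm_pos_iff.mpr (cross_ne_zero (h₁.norm_lt norm_one) (h₂.norm_lt norm_one)))
      (norm_cross_sq _ _ _ _) (norm_cross_sq _ _ _ _), norm_sq_sub_norm_sq_one n₁, norm_sq_sub_norm_sq_one n₂, self2 n₁, self2 n₂]
    at hle
  have d1 := discForm_one n₁ n₂
  have d2 := discForm_circlePoint n₁ n₂ τ
  rw [discForm] at d1 d2
  have pos : ∀ {s p : ℂ}, InSymBidisc s p → 0 ≤ (halfPlaneForm (cayleyMean s p - τ * I)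
        (cayleySqDiff s p) (cayleyMean s p - τ * I) (cayleySqDiff s p)).re := by
    intro s p h
    have hlt := h.norm_lt hv
    have hn := norm_pos_iff.mpr h.one_sub_add_ne_zero
    have h1 : 0 ≤ ‖2 - circlePoint τ * s‖ ^ 2 - ‖2 * circlePoint τ * p - s‖ ^ 2 := by
      nlinarith [norm_nonneg (2 * circlePoint τ * p - s)]
    rw [self2 h.one_sub_add_ne_zero] at h1
    exact nonneg_of_mul_nonneg_right h1 (by positivity)
  rw [d1, d2] at hle
  simp only [norm_mul, norm_div, Complex.norm_conj, Complex.norm_real, Complex.norm_ofNat] at hle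
  rw [Real.norm_of_nonneg (by positivity)] at hle
  rw [hσ₁, hσ₂, hw₁, hw₂]
  refine ⟨pos h₁, pos h₂, ?_⟩
  have m₁ := norm_pos_iff.mpr n₁
  have m₂ := norm_pos_iff.mpr n₂
  refine le_of_mul_le_mul_left ?_
    (show 0 < (4 * ‖1 - s₁ + p₁‖ ^ 2 * ‖1 - s₂ + p₂‖ ^ 2 / (1 + τ ^ 2)) ^ 2 by positivity)
  refine le_trans (le_of_eq ?_) (hle.trans (le_of_eq ?_))
  · field_simp
    ring
  · field_simp
    ring

/-! ### Construction of the analytic disc. -/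

/-- Two-point Pick interpolation from the disc to the right half-plane. -/
theorem exists_halfPlane_map {σ₁ σ₂ l m : ℂ} (h₁ : 0 < σ₁.re) (h₂ : 0 < σ₂.re) (hl : ‖l‖ < 1)
    (hm : ‖m‖ < 1) (hlm : l ≠ m) (h : ‖σ₁ - σ₂‖ / ‖conj σ₁ + σ₂‖ ≤ pseudohyperbolicDist l m) :
    ∃ g : ℂ → ℂ, DifferentiableOn ℂ g (Metric.ball 0 1) ∧
      (∀ z ∈ Metric.ball (0 : ℂ) 1, 0 < (g z).re) ∧ g l = σ₁ ∧ g m = σ₂ := by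
  have ne_of_re : ∀ {z : ℂ}, 0 < z.re → z ≠ 0 := fun hz h0 => by simp [h0] at hz
  have hs : σ₁ + conj σ₂ ≠ 0 := ne_of_re (by simpa using add_pos h₁ h₂)
  have hs' : conj σ₂ + σ₂ ≠ 0 := ne_of_re (by simpa using h₂)
  have hb : (l - m) / (1 - conj m * l) ≠ 0 :=
    div_ne_zero (sub_ne_zero.mpr hlm) (one_sub_conj_mul_ne_zero hm hl)
  -- `q` is the image of σ₁ under the Cayley map sending σ₂ to 0. Multiplication by `k` carries the
  -- Möbius image of `l` to `q`, and the map below undoes the Cayley map.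
  set q : ℂ := (σ₁ - σ₂) / (σ₁ + conj σ₂) with hq
  set k : ℂ := q / ((l - m) / (1 - conj m * l)) with hk
  have hk1 : ‖k‖ ≤ 1 := by
    rw [hk, norm_div]
    refine div_le_one_of_le₀ ?_ (norm_nonneg _)
    have e : ‖q‖ = ‖σ₁ - σ₂‖ / ‖conj σ₁ + σ₂‖ := by
      rw [hq, norm_div, ← Complex.norm_conj (σ₁ + conj σ₂), map_add, conj_conj]
    rw [e]
    exact h
  have hkb : ∀ z ∈ Metric.ball (0 : ℂ) 1, ‖k * ((z - m) / (1 - conj m * z))‖ < 1 := by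
    intro z hz
    rw [norm_mul]
    exact mul_lt_one_of_nonneg_of_lt_one_right hk1 (norm_nonneg _)
      (norm_mobius_lt_one hm (by simpa using hz))
  have hne : ∀ {x : ℂ}, ‖x‖ < 1 → 1 - x ≠ 0 := fun hx h0 => by
    rw [← sub_eq_zero.mp h0, norm_one] at hx
    exact lt_irrefl _ hx
  refine ⟨fun z => (σ₂ + k * ((z - m) / (1 - conj m * z)) * conj σ₂) /
    (1 - k * ((z - m) / (1 - conj m * z))), ?_, ?_, ?_, ?_⟩
  · have hd : DifferentiableOn ℂ (fun z => (z - m) / (1 - conj m * z)) (Metric.ball 0 1) :=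
      DifferentiableOn.div (by fun_prop) (by fun_prop) fun z hz =>
        one_sub_conj_mul_ne_zero hm (by simpa using hz)
    exact DifferentiableOn.div (by fun_prop) (by fun_prop) fun z hz => hne (hkb z hz)
  · intro z hz
    have hx := hkb z hz
    have hx0 := hne hx
    beta_reduce
    generalize k * ((z - m) / (1 - conj m * z)) = x at *
    have hsq : Complex.normSq x < 1 := by
      rw [Complex.normSq_eq_norm_sq]
      nlinarith [norm_nonneg x]
    have hpos : 0 < Complex.normSq (1 - x) := Complex.normSq_pos.mpr hx0
    have e : ((σ₂ + x * conj σ₂) / (1 - x)).re =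
        σ₂.re * (1 - Complex.normSq x) / Complex.normSq (1 - x) := by
      rw [Complex.div_re, ← add_div]
      congr 1
      simp [Complex.normSq_apply]
      ring
    rw [e]
    exact div_pos (mul_pos h₂ (by linarith)) hpos
  · simp only
    have e : k * ((l - m) / (1 - conj m * l)) = q := div_mul_cancel₀ _ hb
    have hq1 : 1 - q ≠ 0 := by
      rw [← e]; exact hne (hkb l (by simpa using hl))
    rw [e, div_eq_iff hq1, hq]
    field_simp
    ring
  · simp

/-- The inverse Cayley transform maps the symmetrized half-plane to the symmetrized bidisc. -/
theorem inClosedSymBidisc_of_re_nonneg {g d : ℂ} (h₁ : 0 ≤ (g + d).re) (h₂ : 0 ≤ (g - d).re) :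
    1 + 2 * g + (g ^ 2 - d ^ 2) ≠ 0 ∧
    InClosedSymBidisc (2 * ((g ^ 2 - d ^ 2) - 1) / (1 + 2 * g + (g ^ 2 - d ^ 2)))
      ((1 - 2 * g + (g ^ 2 - d ^ 2)) / (1 + 2 * g + (g ^ 2 - d ^ 2))) := by
  have e : 1 + 2 * g + (g ^ 2 - d ^ 2) = ((g + d) + 1) * ((g - d) + 1) := by ring
  have hne : ∀ {x : ℂ}, 0 ≤ x.re → x + 1 ≠ 0 := fun {x} hx h0 => by
    have := congrArg re h0
    simp at this
    linarith
  have hc : ∀ {x : ℂ}, 0 ≤ x.re → ‖(x - 1) / (x + 1)‖ ≤ 1 := fun {x} hx => by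
    rw [norm_div]
    refine div_le_one_of_le₀ ?_ (norm_nonneg _)
    refine le_of_sq_le_sq ?_ (norm_nonneg _)
    simp only [← Complex.normSq_eq_norm_sq, Complex.normSq_apply]
    simp
    nlinarith
  have n₁ := hne h₁
  have n₂ := hne h₂
  rw [e]
  refine ⟨mul_ne_zero n₁ n₂, _, _, hc h₁, hc h₂, ?_, ?_⟩
  · rw [div_add_div _ _ n₁ n₂]
    congr 1
    ring
  · rw [div_mul_div_comm]
    congr 1
    ring

/-- When the ratio is maximal at `ω = 1`, there is an analytic disc through the two points. -/
theorem exists_disc_of_isMax_one {s₁ p₁ s₂ p₂ l m : ℂ} (h₁ : InSymBidisc s₁ p₁)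
    (h₂ : InSymBidisc s₂ p₂) (hl : ‖l‖ < 1) (hm : ‖m‖ < 1) (hlm : l ≠ m)
    (hmax : ∀ ω : ℂ, ‖ω‖ = 1 → ‖ratioNum s₁ p₁ s₂ p₂ ω / ratioDen s₁ p₁ s₂ p₂ ω‖ ≤
      ‖ratioNum s₁ p₁ s₂ p₂ 1 / ratioDen s₁ p₁ s₂ p₂ 1‖)
    (hle : ‖ratioNum s₁ p₁ s₂ p₂ 1 / ratioDen s₁ p₁ s₂ p₂ 1‖ ≤ pseudohyperbolicDist l m) :
    ∃ s p : ℂ → ℂ, DifferentiableOn ℂ s (Metric.ball 0 1) ∧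
      DifferentiableOn ℂ p (Metric.ball 0 1) ∧ s l = s₁ ∧ s m = s₂ ∧ p l = p₁ ∧ p m = p₂ ∧
      ∀ z ∈ Metric.ball (0 : ℂ) 1, InClosedSymBidisc (s z) (p z) := by
  have n₁ := h₁.one_sub_add_ne_zero
  have n₂ := h₂.one_sub_add_ne_zero
  rw [norm_ratio_one n₁ n₂] at hle
  -- Equal means make the maximal ratio 0, so the numerator vanishes on the circle, the pairs
  -- coincide and a constant disc works.
  by_cases hσ : cayleyMean s₁ p₁ = cayleyMean s₂ p₂
  · have hz : ∀ ω : ℂ, ‖ω‖ = 1 → ratioNum s₁ p₁ s₂ p₂ ω = 0 := by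
      intro ω hω
      have := hmax ω hω
      rw [norm_ratio_one n₁ n₂, hσ, sub_self, norm_zero, zero_div, norm_le_zero_iff,
        div_eq_zero_iff] at this
      exact this.resolve_right (ratioDen_ne_zero h₁ h₂ hω)
    have z1 := hz 1 (by simp)
    have z2 := hz (-1) (by simp)
    have z3 := hz I (by simp)
    rw [ratioNum] at z1 z2 z3
    rw [I_sq] at z3
    have hp : p₁ = p₂ := by linear_combination (1 / 4 : ℂ) * (z2 - z1)
    subst hp
    have hs : s₁ = s₂ := by linear_combination (1 / 2 : ℂ) * (z1 + z3)
    subst hs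
    exact ⟨fun _ => s₁, fun _ => p₁, by fun_prop, by fun_prop, rfl, rfl, rfl, rfl,
      fun _ _ => h₁.closed⟩
  · have r₁ := cayleyMean_re_pos h₁
    have r₂ := cayleyMean_re_pos h₂
    have H := halfPlaneForm_of_isMax_one h₁ h₂ hmax rfl rfl rfl rfl
    obtain ⟨α, β, γ, e₁, e₂⟩ := exists_quadratic_of_halfPlaneForm r₁ r₂ hσ (fun τ => (H τ).1)
      (fun τ => (H τ).2.1) (fun τ => (H τ).2.2)
    obtain ⟨hα, hq⟩ := quadratic_bounds_of_halfPlaneForm r₁ r₂ hσ e₁ e₂ (fun τ => (H τ).1)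
      (fun τ => (H τ).2.1) (fun τ => (H τ).2.2)
    obtain ⟨g, hg, hgre, hgl, hgm⟩ := exists_halfPlane_map r₁ r₂ hl hm hlm hle
    set w : ℂ → ℂ := fun z => α * z ^ 2 + β * I * z + γ with hw
    have inside : ∀ z ∈ Metric.ball (0 : ℂ) 1, 1 + 2 * g z + (g z ^ 2 - w (g z)) ≠ 0 ∧
        InClosedSymBidisc
          (2 * ((g z ^ 2 - w (g z)) - 1) / (1 + 2 * g z + (g z ^ 2 - w (g z))))
          ((1 - 2 * g z + (g z ^ 2 - w (g z))) / (1 + 2 * g z + (g z ^ 2 - w (g z)))) := by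
      intro z hz
      -- A pointwise root suffices: only d² enters the formulas, so no analytic branch is needed.
      obtain ⟨d, hd⟩ := IsAlgClosed.exists_pow_nat_eq (w (g z)) (n := 2) (by norm_num)
      rw [← hd]
      refine inClosedSymBidisc_of_re_nonneg (re_nonneg_of_sq_eq_quadratic hα hq (hgre z hz) hd) ?_
      rw [sub_eq_add_neg]
      exact re_nonneg_of_sq_eq_quadratic hα hq (hgre z hz) (by rw [neg_sq, hd])
    have recover : ∀ {s p : ℂ}, 1 - s + p ≠ 0 → ∀ {x y : ℂ}, x = cayleyMean s p →
        y = cayleySqDiff s p → 2 * ((x ^ 2 - y) - 1) / (1 + 2 * x + (x ^ 2 - y)) = s ∧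
          (1 - 2 * x + (x ^ 2 - y)) / (1 + 2 * x + (x ^ 2 - y)) = p := by
      intro s p hn x y hx hy
      have hxy : x ^ 2 - y = (1 + s + p) / (1 - s + p) := by rw [hx, hy, cayleySqDiff]; ring
      have hden : 1 + 2 * x + (x ^ 2 - y) = 4 / (1 - s + p) := by
        rw [hxy, hx, cayleyMean]; field_simp; ring
      rw [hden, hxy, hx, cayleyMean]
      constructor <;> field_simp <;> ring
    refine ⟨fun z => 2 * ((g z ^ 2 - w (g z)) - 1) / (1 + 2 * g z + (g z ^ 2 - w (g z))),
      fun z => (1 - 2 * g z + (g z ^ 2 - w (g z))) / (1 + 2 * g z + (g z ^ 2 - w (g z))),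
      ?_, ?_, ?_, ?_, ?_, ?_, fun z hz => (inside z hz).2⟩
    · exact DifferentiableOn.div (by fun_prop) (by fun_prop) fun z hz => (inside z hz).1
    · exact DifferentiableOn.div (by fun_prop) (by fun_prop) fun z hz => (inside z hz).1
    · exact (recover n₁ hgl (by rw [e₁, hgl])).1
    · exact (recover n₂ hgm (by rw [e₂, hgm])).1
    · exact (recover n₁ hgl (by rw [e₁, hgl])).2
    · exact (recover n₂ hgm (by rw [e₂, hgm])).2

/-- Multiplying both roots by ω moves the parameter from v to ωv. -/
theorem ratioNum_rotate (s₁ p₁ s₂ p₂ ω v : ℂ) :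
    ratioNum (ω * s₁) (ω ^ 2 * p₁) (ω * s₂) (ω ^ 2 * p₂) v =
      ω * ratioNum s₁ p₁ s₂ p₂ (ω * v) := by
  unfold ratioNum; ring

theorem ratioDen_rotate (s₁ p₁ s₂ p₂ v : ℂ) {ω : ℂ} (hω : ‖ω‖ = 1) :
    ω * ratioDen (ω * s₁) (ω ^ 2 * p₁) (ω * s₂) (ω ^ 2 * p₂) v =
      ratioDen s₁ p₁ s₂ p₂ (ω * v) := by
  have h : conj ω * ω = 1 := by rw [Complex.conj_mul', hω]; simp
  unfold ratioDen
  simp only [map_mul, map_pow]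
  generalize conj ω = o at h ⊢
  linear_combination (-ω ^ 2 * v ^ 2 * conj s₂ * p₁ + 2 * ω * v * p₁ * conj p₂ * (o * ω + 1) +
    conj s₂ - s₁ * conj p₂ * (o * ω + 1)) * h

theorem InSymBidisc.rotate {s p ω : ℂ} (h : InSymBidisc s p) (hω : ‖ω‖ = 1) :
    InSymBidisc (ω * s) (ω ^ 2 * p) := by
  obtain ⟨z, w, hz, hw, rfl, rfl⟩ := h
  exact ⟨ω * z, ω * w, by simpa [hω], by simpa [hω], by ring, by ring⟩

theorem InClosedSymBidisc.rotate {s p ω : ℂ} (h : InClosedSymBidisc s p) (hω : ‖ω‖ = 1) :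
    InClosedSymBidisc (ω * s) (ω ^ 2 * p) := by
  obtain ⟨z, w, hz, hw, rfl, rfl⟩ := h
  exact ⟨ω * z, ω * w, by simpa [hω], by simpa [hω], by ring, by ring⟩

/-- Two-point interpolation into the symmetrized bidisc. -/
theorem exists_disc_of_ratio_le {s₁ p₁ s₂ p₂ l m : ℂ} (h₁ : InSymBidisc s₁ p₁)
    (h₂ : InSymBidisc s₂ p₂) (hl : ‖l‖ < 1) (hm : ‖m‖ < 1) (hlm : l ≠ m)
    (hle : ∀ ω ∈ unitCircle,
      ‖ratioNum s₁ p₁ s₂ p₂ ω / ratioDen s₁ p₁ s₂ p₂ ω‖ ≤ pseudohyperbolicDist l m) :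
    ∃ s p : ℂ → ℂ, DifferentiableOn ℂ s (Metric.ball 0 1) ∧
      DifferentiableOn ℂ p (Metric.ball 0 1) ∧ s l = s₁ ∧ s m = s₂ ∧ p l = p₁ ∧ p m = p₂ ∧
      ∀ z ∈ Metric.ball (0 : ℂ) 1, InClosedSymBidisc (s z) (p z) := by
  obtain ⟨M, ⟨⟨ω, hω, hMω⟩, hub⟩, hM⟩ := (exists_isGreatest_ratio_iff h₁ h₂ _).mpr hle
  have hω' : ‖ω‖ = 1 := by simpa [unitCircle] using hω
  have hω0 : ω ≠ 0 := fun h => by simp [h] at hω'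
  have hrot : ∀ v : ℂ, ‖ratioNum (ω * s₁) (ω ^ 2 * p₁) (ω * s₂) (ω ^ 2 * p₂) v /
      ratioDen (ω * s₁) (ω ^ 2 * p₁) (ω * s₂) (ω ^ 2 * p₂) v‖ =
      ‖ratioNum s₁ p₁ s₂ p₂ (ω * v) / ratioDen s₁ p₁ s₂ p₂ (ω * v)‖ := by
    intro v
    rw [← ratioDen_rotate _ _ _ _ _ hω', ratioNum_rotate, norm_div, norm_div, norm_mul, norm_mul,
      hω', one_mul, one_mul]
  obtain ⟨s, p, hs, hp, e₁, e₂, e₃, e₄, hG⟩ := exists_disc_of_isMax_one (h₁.rotate hω')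
    (h₂.rotate hω') hl hm hlm (fun v hv => by
      rw [hrot, hrot, mul_one]
      refine (hub ⟨ω * v, by simp [unitCircle, hω', hv], rfl⟩).trans hMω.ge) (by
      rw [hrot, mul_one]
      exact hle ω hω)
  refine ⟨fun z => ω⁻¹ * s z, fun z => ω⁻¹ ^ 2 * p z, by fun_prop, by fun_prop, ?_, ?_, ?_, ?_,
    fun z hz => (hG z hz).rotate (by simp [hω'])⟩ <;> simp only [e₁, e₂, e₃, e₄] <;> field_simp

/-! ### Lifting from traces and determinants to matrices. -/

/-- The polynomial vanishes at t exactly when (1, t) is an eigenvector of W. -/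
theorem IsNonscalar.exists_coeff_ne_zero {W : Matrix (Fin 2) (Fin 2) ℂ} (h : IsNonscalar W) :
    Polynomial.C (W 1 0) + Polynomial.C (W 1 1 - W 0 0) * Polynomial.X -
      Polynomial.C (W 0 1) * Polynomial.X ^ 2 ≠ 0 := by
  intro h0
  have c0 := congrArg (Polynomial.eval 0) h0
  have c1 := congrArg (Polynomial.eval 1) h0
  have c2 := congrArg (Polynomial.eval (-1)) h0
  simp at c0 c1 c2
  refine h (W 0 0) ?_
  ext i j
  fin_cases i <;> fin_cases j <;> simp
  · linear_combination (-1 / 2 : ℂ) * (c1 + c2) + c0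
  · exact c0
  · linear_combination (1 / 2 : ℂ) * (c1 - c2)

/-- Two nonscalar matrices have a common noneigenvector of the form `(1, t)`. -/
theorem exists_common_cyclic {W₁ W₂ : Matrix (Fin 2) (Fin 2) ℂ} (h₁ : IsNonscalar W₁)
    (h₂ : IsNonscalar W₂) : ∃ t : ℂ, W₁ 1 0 + (W₁ 1 1 - W₁ 0 0) * t - W₁ 0 1 * t ^ 2 ≠ 0 ∧
      W₂ 1 0 + (W₂ 1 1 - W₂ 0 0) * t - W₂ 0 1 * t ^ 2 ≠ 0 := by
  by_contra! hcon
  refine mul_ne_zero h₁.exists_coeff_ne_zero h₂.exists_coeff_ne_zero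
    (Polynomial.funext fun t => ?_)
  rw [Polynomial.eval_mul, Polynomial.eval_zero, mul_eq_zero]
  by_cases h : W₁ 1 0 + (W₁ 1 1 - W₁ 0 0) * t - W₁ 0 1 * t ^ 2 = 0
  · left; simpa using h
  · right; simpa using hcon t h

theorem exists_affine_interpolation {l m : ℂ} (hlm : l ≠ m) (a b : ℂ) :
    ∃ f : ℂ → ℂ, Differentiable ℂ f ∧ f l = a ∧ f m = b := by
  have := sub_ne_zero.mpr hlm
  refine ⟨fun z => b + (a - b) / (l - m) * (z - m), by fun_prop, ?_, by simp⟩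
  field_simp
  ring

/-- A disc of traces and determinants through two nonscalar matrices lifts to a disc of matrices. -/
theorem exists_matrix_lift {l m : ℂ} (hlm : l ≠ m) {W₁ W₂ : Matrix (Fin 2) (Fin 2) ℂ}
    (h₁ : IsNonscalar W₁) (h₂ : IsNonscalar W₂) {s p : ℂ → ℂ} {U : Set ℂ} (hU : IsOpen U)
    (hs : DifferentiableOn ℂ s U) (hp : DifferentiableOn ℂ p U) (hs₁ : s l = W₁.trace)
    (hs₂ : s m = W₂.trace) (hp₁ : p l = W₁.det) (hp₂ : p m = W₂.det) :
    ∃ F : ℂ → Matrix (Fin 2) (Fin 2) ℂ, IsAnalyticMatrixOn F U ∧ F l = W₁ ∧ F m = W₂ ∧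
      ∀ z, (F z).trace = s z ∧ (F z).det = p z := by
  obtain ⟨t, t₁, t₂⟩ := exists_common_cyclic h₁ h₂
  -- In the basis v = (1, t), e₂ = (0, 1) the lift is [[x, b], [exp y, s - x]]. Interpolating
  -- logarithms keeps the lower-left entry nonzero, so `b` can be solved from the determinant.
  obtain ⟨x, hx, x₁, x₂⟩ := exists_affine_interpolation hlm (W₁ 0 0 + W₁ 0 1 * t)
    (W₂ 0 0 + W₂ 0 1 * t)
  obtain ⟨y, hy, y₁, y₂⟩ := exists_affine_interpolation hlm
    (log (W₁ 1 0 + (W₁ 1 1 - W₁ 0 0) * t - W₁ 0 1 * t ^ 2))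
    (log (W₂ 1 0 + (W₂ 1 1 - W₂ 0 0) * t - W₂ 0 1 * t ^ 2))
  set b : ℂ → ℂ := fun z => (x z * (s z - x z) - p z) / exp (y z) with hb
  have hbd : DifferentiableOn ℂ b U := by
    have := hx.differentiableOn (s := U)
    have := hy.differentiableOn (s := U)
    exact DifferentiableOn.div (by fun_prop) (by fun_prop) fun z _ => exp_ne_zero _
  have value : ∀ {u : ℂ} {W : Matrix (Fin 2) (Fin 2) ℂ}, s u = W.trace → p u = W.det →
      W 1 0 + (W 1 1 - W 0 0) * t - W 0 1 * t ^ 2 ≠ 0 → x u = W 0 0 + W 0 1 * t →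
      y u = log (W 1 0 + (W 1 1 - W 0 0) * t - W 0 1 * t ^ 2) →
      !![x u - t * b u, b u; t * x u + exp (y u) - t * (t * b u + (s u - x u)),
        t * b u + (s u - x u)] = W := by
    intro u W hsu hpu ht hxu hyu
    have he : exp (y u) = W 1 0 + (W 1 1 - W 0 0) * t - W 0 1 * t ^ 2 := by
      rw [hyu, exp_log ht]
    have hbu : b u = W 0 1 := by
      simp only [b]
      rw [he, div_eq_iff ht, hsu, hpu, hxu, Matrix.trace_fin_two, Matrix.det_fin_two]
      ring
    rw [hbu, he, hsu, hxu, Matrix.trace_fin_two]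
    ext i j
    fin_cases i <;> fin_cases j <;> simp <;> ring
  refine ⟨fun z => !![x z - t * b z, b z; t * x z + exp (y z) - t * (t * b z + (s z - x z)),
    t * b z + (s z - x z)], ?_, value hs₁ hp₁ t₁ x₁ y₁, value hs₂ hp₂ t₂ x₂ y₂, fun z => ⟨?_, ?_⟩⟩
  · intro i j
    have := hx.differentiableOn (s := U)
    have := hy.differentiableOn (s := U)
    refine DifferentiableOn.analyticOnNhd ?_ hU
    fin_cases i <;> fin_cases j <;> simp <;> fun_prop
  · rw [Matrix.trace_fin_two_of]
    ring
  · have : b z * exp (y z) = x z * (s z - x z) - p z := div_mul_cancel₀ _ (exp_ne_zero _)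
    rw [Matrix.det_fin_two_of]
    linear_combination -this

theorem theorem1p1 (lam₁ lam₂ : ℂ) (hlam₁ : lam₁ ∈ openDisc) (hlam₂ : lam₂ ∈ openDisc)
    (hne : lam₁ ≠ lam₂)
    (W₁ W₂ : Matrix (Fin 2) (Fin 2) ℂ) (hW₁ : IsNonscalar W₁) (hW₂ : IsNonscalar W₂)
    (hr₁ : spectralRadius ℂ W₁ < 1) (hr₂ : spectralRadius ℂ W₂ < 1)
    (s₁ s₂ p₁ p₂ : ℂ) (hs₁ : s₁ = W₁.trace) (hs₂ : s₂ = W₂.trace)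
    (hp₁ : p₁ = W₁.det) (hp₂ : p₂ = W₂.det) :
    (∀ ω ∈ unitCircle, ratioDen s₁ p₁ s₂ p₂ ω ≠ 0) ∧
    List.TFAE [
      ∃ F : ℂ → Matrix (Fin 2) (Fin 2) ℂ, IsAnalyticMatrixOn F openDisc ∧
        F lam₁ = W₁ ∧ F lam₂ = W₂ ∧ ∀ z ∈ openDisc, spectralRadius ℂ (F z) ≤ 1,
      ∃ M : ℝ, IsGreatest
          ((fun ω => ‖ratioNum s₁ p₁ s₂ p₂ ω / ratioDen s₁ p₁ s₂ p₂ ω‖) '' unitCircle) M ∧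
        M ≤ pseudohyperbolicDist lam₁ lam₂,
      ∀ ω ∈ unitCircle, (pickMatrix ![lam₁, lam₂] ![s₁, s₂] ![p₁, p₂] ω).PosSemidef] := by
  subst hs₁ hs₂ hp₁ hp₂
  have h₁ := inSymBidisc_of_spectralRadius_lt hr₁
  have h₂ := inSymBidisc_of_spectralRadius_lt hr₂
  have hl : ‖lam₁‖ < 1 := by simpa [openDisc] using hlam₁
  have hm : ‖lam₂‖ < 1 := by simpa [openDisc] using hlam₂
  have circle : ∀ {ω : ℂ}, ω ∈ unitCircle → ‖ω‖ = 1 := fun hω => by simpa [unitCircle] using hω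
  refine ⟨fun ω hω => ratioDen_ne_zero h₁ h₂ (circle hω), ?_⟩
  tfae_have 2 ↔ 3 := by
    rw [exists_isGreatest_ratio_iff h₁ h₂]
    exact forall₂_congr fun ω hω => (pickMatrix_posSemidef_iff h₁ h₂ (circle hω) hl hm).symm
  tfae_have 1 → 2 := by
    rintro ⟨F, hF, rfl, rfl, hr⟩
    rw [exists_isGreatest_ratio_iff h₁ h₂]
    intro ω hω
    have hs : AnalyticOnNhd ℂ (fun z => (F z).trace) (Metric.ball 0 1) := by
      simp only [Matrix.trace_fin_two]
      exact (hF 0 0).add (hF 1 1)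
    have hp : AnalyticOnNhd ℂ (fun z => (F z).det) (Metric.ball 0 1) := by
      simp only [Matrix.det_fin_two]
      exact ((hF 0 0).mul (hF 1 1)).sub ((hF 0 1).mul (hF 1 0))
    exact ratio_le_of_analytic hs hp (fun z hz => (spectralRadius_le_one_iff _).mp (hr z hz))
      hl hm h₁ (circle hω)
  tfae_have 2 → 1 := by
    rw [exists_isGreatest_ratio_iff h₁ h₂]
    intro h
    obtain ⟨s, p, hs, hp, e₁, e₂, e₃, e₄, hG⟩ := exists_disc_of_ratio_le h₁ h₂ hl hm hne h
    obtain ⟨F, hF, hF₁, hF₂, hFz⟩ := exists_matrix_lift hne hW₁ hW₂ Metric.isOpen_ball hs hp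
      e₁ e₂ e₃ e₄
    refine ⟨F, hF, hF₁, hF₂, fun z hz => (spectralRadius_le_one_iff _).mpr ?_⟩
    rw [(hFz z).1, (hFz z).2]
    exact hG z hz
  tfae_finish
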